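/- Let $R$ be a commutative Noetherian ring with identity, $\mathfrak a$ an ideal of $R$, and $M$ a finitely generated $R$-module with $M\neq\mathfrak aM$. For an $R$-module $N$ and $i\ge 0$ let $H^i_{\mathfrak a}(N)=\varinjlim_n \operatorname{Ext}^i_R(R/\mathfrak a^n,N)$ be the $i$-th local cohomology module, let $\operatorname{cd}(\mathfrak a,N)$ be the largest $i$ with $H^i_{\mathfrak a}(N)\neq 0$, and let $\mathfrak a\text{-}\operatorname{id}_R N=\sup\{i\ge 0\mid \operatorname{Ext}^i_R(R/\mathfrak a,N)\neq 0\}$ be the $\mathfrak a$-relative injective dimension of $N$. For a finitely generated $R$-module $N$, let $\operatorname{grade}(\mathfrak a,N)$ be the supremum of the lengths of the $N$-regular sequences contained in $\mathfrak a$ if $N\ne\mathfrak aN$, and $\infty$ if $N=\mathfrak aN$; call $N$ $\mathfrak a$-relative Gorenstein if $\operatorname{Ext}^i_R(R/\mathfrak a,N)=0$ for all $i\neq\operatorname{cd}(\mathfrak a,R)$, and $\mathfrak a$-relative maximal Cohen-Macaulay if $\operatorname{grade}(\mathfrak a,N)=\operatorname{cd}(\mathfrak a,R)$. Theorem 3.2.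 The cohomological dimension $c=\operatorname{cd}(\mathfrak a,R)$ is a non-negative integer, and the following are equivalent: (i) $M$ is $\mathfrak a$-relative Gorenstein; (ii) $M$ is $\mathfrak a$-relative maximal Cohen-Macaulay and $\mathfrak a\text{-}\operatorname{id}_R(H^c_{\mathfrak a}(M))=0$; (iii) $M$ is $\mathfrak a$-relative maximal Cohen-Macaulay and $\operatorname{Ext}^i_R(R/\mathfrak a,M)=0$ for all $i>c$. -/

import Mathlib

open CategoryTheory

universe u

noncomputable section

namespace RelHomology

variable {R : Type u} [CommRing R]

/-- The `R`-module `Ext_R^i(X, N)`. -/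
abbrev ExtMod (X N : Type u) [AddCommGroup X] [Module R X] [AddCommGroup N] [Module R N]
    (i : ℕ) : Type u :=
  Abelian.Ext (ModuleCat.of R X) (ModuleCat.of R N) i

/-- The map `Ext_R^i(R/𝔞^m, N) → Ext_R^i(R/𝔞^n, N)`, for `m ≤ n`, that is induced by the
canonical surjection `R/𝔞^n → R/𝔞^m`. -/
def extTransition (𝔞 : Ideal R) (N : Type u) [AddCommGroup N] [Module R N] (i m n : ℕ)
    (h : m ≤ n) :
    ExtMod (R := R) (R ⧸ 𝔞 ^ m) N i →ₗ[R] ExtMod (R := R) (R ⧸ 𝔞 ^ n) N i :=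
  (Abelian.Ext.mk₀ (ModuleCat.ofHom
    (Submodule.factor (Ideal.pow_le_pow_right (I := 𝔞) h)))).precompOfLinear R
      (ModuleCat.of R N) (zero_add i)

/-- The transition maps form a directed system. -/
instance extTransition_directedSystem (𝔞 : Ideal R) (N : Type u) [AddCommGroup N] [Module R N]
    (i : ℕ) :
    DirectedSystem (fun n : ℕ => ExtMod (R := R) (R ⧸ 𝔞 ^ n) N i)
      (fun m n h => extTransition 𝔞 N i m n h) where
  map_self n x := by
    have : Submodule.factor (Ideal.pow_le_pow_right (I := 𝔞) (le_refl n)) = LinearMap.id := by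
      ext; rfl
    simp only [extTransition, this, Abelian.Ext.bilinearCompOfLinear_apply_apply]
    exact Abelian.Ext.mk₀_id_comp x
  map_map k j i' hij hjk x := by
    simp only [extTransition, Abelian.Ext.bilinearCompOfLinear_apply_apply,
      Abelian.Ext.mk₀_comp_mk₀_assoc, ← ModuleCat.ofHom_comp, Submodule.factor_comp]

/-- The `i`-th local cohomology module `H_𝔞^i(N) = colim_n Ext_R^i(R/𝔞^n, N)`. -/
abbrev LocalCoh (𝔞 : Ideal R) (i : ℕ) (N : Type u) [AddCommGroup N] [Module R N] : Type u :=
  Module.DirectLimit (fun n : ℕ => ExtMod (R := R) (R ⧸ 𝔞 ^ n) N i)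
    (fun m n h => extTransition 𝔞 N i m n h)

/-- The cohomological dimension `cd(𝔞, N)`: the largest `i` with `H_𝔞^i(N) ≠ 0`, taken as a
supremum in `ℕ ∪ {-∞, ∞}`. -/
def cd (𝔞 : Ideal R) (N : Type u) [AddCommGroup N] [Module R N] : WithBot ℕ∞ :=
  ⨆ (i : ℕ) (_ : Nontrivial (LocalCoh 𝔞 i N)), (i : WithBot ℕ∞)

open Classical in
/-- `grade(𝔞, N)` of a finitely generated module `N`: the supremum of the lengths of the
`N`-regular sequences of elements of `𝔞` if `𝔞N ≠ N`, and `∞` if `𝔞N = N`. -/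
def idealGrade (𝔞 : Ideal R) (N : Type u) [AddCommGroup N] [Module R N] : ℕ∞ :=
  if 𝔞 • (⊤ : Submodule R N) = ⊤ then ⊤
  else ⨆ (rs : List R) (_ : (∀ r ∈ rs, r ∈ 𝔞) ∧ RingTheory.Sequence.IsRegular N rs),
    (rs.length : ℕ∞)

/-- The `𝔞`-relative injective dimension of a module `N` (not necessarily finitely generated):
`sup {i | Ext_R^i(R/𝔞, N) ≠ 0}`, with `sup ∅ = -∞`. -/
def relInjDim (𝔞 : Ideal R) (N : Type u) [AddCommGroup N] [Module R N] : WithBot ℕ∞ :=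
  ⨆ (i : ℕ) (_ : Nontrivial (ExtMod (R := R) (R ⧸ 𝔞) N i)), (i : WithBot ℕ∞)

/-- A finitely generated module `N` is `𝔞`-relative Gorenstein if `Ext_R^i(R/𝔞, N) = 0` for all
`i ≠ cd(𝔞, R)`. -/
def IsRelGorenstein (𝔞 : Ideal R) (N : Type u) [AddCommGroup N] [Module R N] : Prop :=
  ∀ i : ℕ, (i : WithBot ℕ∞) ≠ cd 𝔞 R → Subsingleton (ExtMod (R := R) (R ⧸ 𝔞) N i)

/-- A finitely generated module `N` is `𝔞`-relative maximal Cohen-Macaulay if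
`grade(𝔞, N) = cd(𝔞, R)`. -/
def IsRelMaximalCM (𝔞 : Ideal R) (N : Type u) [AddCommGroup N] [Module R N] : Prop :=
  (idealGrade 𝔞 N : WithBot ℕ∞) = cd 𝔞 R

end RelHomology

end

/-! Write `g` for the grade of `M`. It is the least degree in which `Ext(R/𝔞, M)` is nonzero
(`exists_idealGrade_eq`). If `M` is relative Gorenstein, the only degree that can carry a nonzero
`Ext` is `c`, so `g = c`; together with vanishing above `c` this gives (i) ⇔ (iii).

For (ii) ⇔ (iii), suppose `g = c`. Local cohomology of `M` vanishes below `c` because each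
`Ext(R/𝔞^n, M)` does, and above `c` because `M` is a quotient of a finite free module
(`LocalCohVanishes.of_finite`). When local cohomology is concentrated in degree `c`, `Ext^i(R/𝔞,
H^c(M))` vanishes exactly when `Ext^(i+c)(R/𝔞, M)` does (`subsingleton_ext_localCoh_iff`). This
replaces a degenerate spectral sequence by dimension shifting along embeddings into `𝔞`-torsion-free
injectives, which have no `Ext` from `R/𝔞^n` at all.

That `c` is a natural number has two halves: local cohomology vanishes above the number of
generators of `𝔞` (`LocalCohVanishes.of_card_lt`), and it cannot vanish in every degree, since then
every `Ext(R/𝔞, R)` would vanish (`subsingleton_ext_of_localCohVanishes`,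
`exists_not_subsingleton_ext`). -/

namespace RelHomology

open Abelian

variable {R : Type u} [CommRing R]

/-! ### Vanishing criteria and connecting maps for Ext -/

section Ext

variable {A B C : Type u} [AddCommGroup A] [Module R A] [AddCommGroup B] [Module R B]
  [AddCommGroup C] [Module R C] {f : A →ₗ[R] B} {g : B →ₗ[R] C}

/-- The short complex of module categories attached to an exact pair of linear maps. -/
abbrev exactPair (hfg : Function.Exact f g) : ShortComplex (ModuleCat.{u} R) :=
  ModuleCat.shortComplexOfCompEqZero f g hfg.linearMap_comp_eq_zero

theorem exactPair_shortExact (hf : Function.Injective f) (hfg : Function.Exact f g)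
    (hg : Function.Surjective g) : (exactPair hfg).ShortExact :=
  ModuleCat.shortComplex_shortExact (exactPair hfg) hfg hf hg

theorem subsingleton_ext_of_injective [Module.Injective R A] (X : ModuleCat.{u} R) (i : ℕ) :
    Subsingleton (Ext X (ModuleCat.of R A) (i + 1)) :=
  haveI := Module.injective_object_of_injective_module R A
  Ext.subsingleton_of_injective X _ i

theorem subsingleton_ext_congr (e : A ≃ₗ[R] B) (X : ModuleCat.{u} R) (i : ℕ) :
    Subsingleton (Ext X (ModuleCat.of R A) i) ↔ Subsingleton (Ext X (ModuleCat.of R B) i) := by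
  have key : ∀ {A B : Type u} [AddCommGroup A] [Module R A] [AddCommGroup B] [Module R B]
      (_ : A ≃ₗ[R] B), Subsingleton (Ext X (ModuleCat.of R A) i) →
      Subsingleton (Ext X (ModuleCat.of R B) i) := by
    intro A B _ _ _ _ e h
    refine subsingleton_of_forall_eq 0 fun x => ?_
    have h1 : x.comp (Ext.mk₀ (ModuleCat.ofHom e.symm.toLinearMap)) (add_zero i) = 0 :=
      Subsingleton.elim _ _
    have h2 := congrArg
      (fun y => Ext.comp y (Ext.mk₀ (ModuleCat.ofHom e.toLinearMap)) (add_zero i)) h1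
    have h3 : ModuleCat.ofHom e.symm.toLinearMap ≫ ModuleCat.ofHom e.toLinearMap = 𝟙 _ := by
      ext; simp
    simpa [Ext.comp_assoc_of_third_deg_zero, h3] using h2
  exact ⟨key e, key e.symm⟩

theorem smul_ext_eq_zero {X : ModuleCat.{u} R} {N : ModuleCat.{u} R} {i : ℕ} (x : Ext X N i)
    {r : R} (hr : ∀ y : X, r • y = 0) : r • x = 0 := by
  have h1 : r • 𝟙 X = 0 := by ext y; exact hr y
  have h2 : r • x = (Ext.mk₀ (r • 𝟙 X)).comp x (zero_add i) := by simp [Ext.mk₀_smul]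
  rw [h2, h1, Ext.mk₀_zero, Ext.zero_comp]

/-- If `r` kills `X` and acts bijectively on `A`, then all `Ext(X, A)` vanish. -/
theorem subsingleton_ext_of_smul_bijective {X : ModuleCat.{u} R} {r : R}
    (hr : ∀ y : X, r • y = 0) (hA : Function.Bijective fun a : A => r • a) (i : ℕ) :
    Subsingleton (Ext X (ModuleCat.of R A) i) := by
  let e : A ≃ₗ[R] A := LinearEquiv.ofBijective (LinearMap.lsmul R A r) hA
  refine subsingleton_of_forall_eq 0 fun x => ?_
  have h1 := smul_ext_eq_zero
    (x.comp (Ext.mk₀ (ModuleCat.ofHom e.symm.toLinearMap)) (add_zero i)) hr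
  have h2 : r • ModuleCat.ofHom e.symm.toLinearMap = 𝟙 (ModuleCat.of R A) := by
    ext a
    exact e.apply_symm_apply a
  rw [← Ext.comp_smul, ← Ext.mk₀_smul, h2, Ext.comp_mk₀_id] at h1
  exact h1

theorem subsingleton_ext_zero {X : ModuleCat.{u} R} (h : ∀ φ : X →ₗ[R] A, φ = 0) :
    Subsingleton (Ext X (ModuleCat.of R A) 0) :=
  haveI : Subsingleton (X →ₗ[R] A) := subsingleton_of_forall_eq 0 h
  (Ext.addEquiv₀.trans ModuleCat.homAddEquiv).subsingleton

/-- The connecting maps are bijective when the middle term has no `Ext`. -/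
theorem extClass_comp_bijective (hf : Function.Injective f) (hfg : Function.Exact f g)
    (hg : Function.Surjective g) {X : ModuleCat.{u} R} {i : ℕ}
    (h0 : Subsingleton (Ext X (ModuleCat.of R B) i))
    (h1 : Subsingleton (Ext X (ModuleCat.of R B) (i + 1))) :
    Function.Bijective ((exactPair_shortExact hf hfg hg).extClass.postcompOfLinear R X
      (rfl : i + 1 = i + 1)) := by
  constructor
  · refine (injective_iff_map_eq_zero _).2 fun x hx => ?_
    obtain ⟨y, rfl⟩ := Ext.covariant_sequence_exact₃ X (exactPair_shortExact hf hfg hg) x rfl hx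
    rw [(Subsingleton.elim y 0 : y = 0), Ext.zero_comp]
  · intro x
    exact Ext.covariant_sequence_exact₁ X (exactPair_shortExact hf hfg hg) x
      (Subsingleton.elim (α := Ext X (ModuleCat.of R B) (i + 1)) _ _) rfl

end Ext

/-! ### Vanishing of local cohomology along short exact sequences -/

section Vanishing

/-- The canonical surjection `R/𝔞^n → R/𝔞^m` for `m ≤ n`. -/
abbrev powFactor (𝔞 : Ideal R) {m n : ℕ} (h : m ≤ n) :
    ModuleCat.of R (R ⧸ 𝔞 ^ n) ⟶ ModuleCat.of R (R ⧸ 𝔞 ^ m) :=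
  ModuleCat.ofHom (Submodule.factor (Ideal.pow_le_pow_right (I := 𝔞) h))

theorem powFactor_comp (𝔞 : Ideal R) {l m n : ℕ} (h : l ≤ m) (h' : m ≤ n) :
    powFactor 𝔞 h' ≫ powFactor 𝔞 h = powFactor 𝔞 (h.trans h') := by
  simp only [powFactor, ← ModuleCat.ofHom_comp, Submodule.factor_comp]

/-- Vanishing of the `i`-th local cohomology, in terms of elements of the directed system. -/
def LocalCohVanishes (𝔞 : Ideal R) (i : ℕ) (N : Type u) [AddCommGroup N] [Module R N] : Prop :=
  ∀ (m : ℕ) (x : ExtMod (R := R) (R ⧸ 𝔞 ^ m) N i), ∃ (n : ℕ) (h : m ≤ n),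
    (Ext.mk₀ (powFactor 𝔞 h)).comp x (zero_add i) = 0

variable {𝔞 : Ideal R} {A B C : Type u} [AddCommGroup A] [Module R A] [AddCommGroup B] [Module R B]
  [AddCommGroup C] [Module R C] {f : A →ₗ[R] B} {g : B →ₗ[R] C}

theorem subsingleton_localCoh_iff (i : ℕ) :
    Subsingleton (LocalCoh 𝔞 i A) ↔ LocalCohVanishes 𝔞 i A := by
  constructor
  · intro _ m x
    obtain ⟨n, h, hn⟩ := Module.DirectLimit.of.zero_exact
      (f := fun m n h => extTransition 𝔞 A i m n h)
      (Subsingleton.elim (α := LocalCoh 𝔞 i A) (Module.DirectLimit.of R ℕ _ _ m x) 0)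
    exact ⟨n, h, hn⟩
  · intro H
    refine subsingleton_of_forall_eq 0 fun z => ?_
    obtain ⟨m, x, rfl⟩ := Module.DirectLimit.exists_of z
    obtain ⟨n, h, hn⟩ := H m x
    rw [← Module.DirectLimit.of_f (hij := h)]
    exact (congrArg _ hn).trans (map_zero _)

theorem LocalCohVanishes.of_subsingleton_ext {i : ℕ}
    (h : ∀ n, Subsingleton (ExtMod (R := R) (R ⧸ 𝔞 ^ n) A i)) : LocalCohVanishes 𝔞 i A :=
  fun m x => ⟨m, le_rfl, by rw [(h m).elim x 0, Ext.comp_zero]⟩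

theorem LocalCohVanishes.of_injective [Module.Injective R A] (i : ℕ) :
    LocalCohVanishes 𝔞 (i + 1) A :=
  .of_subsingleton_ext fun _ => subsingleton_ext_of_injective _ i

/-- Exactness survives the direct limit: enlarge the power of `𝔞` until the image in the next term
dies, lift through the long exact `Ext` sequence, then enlarge again to kill the lift. The two
lemmas that follow use the same chase. -/
theorem LocalCohVanishes.middle (hf : Function.Injective f) (hfg : Function.Exact f g)
    (hg : Function.Surjective g) {i : ℕ} (hA : LocalCohVanishes 𝔞 i A)
    (hC : LocalCohVanishes 𝔞 i C) : LocalCohVanishes 𝔞 i B := by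
  intro m x
  obtain ⟨n, h, hn⟩ := hC m (x.comp (Ext.mk₀ (ModuleCat.ofHom g)) (add_zero i))
  rw [← Ext.comp_assoc_of_third_deg_zero] at hn
  obtain ⟨y, hy⟩ := Ext.covariant_sequence_exact₂ _ (exactPair_shortExact hf hfg hg) _ hn
  obtain ⟨k, h', hk⟩ := hA n y
  refine ⟨k, h.trans h', ?_⟩
  rw [← powFactor_comp 𝔞 h h', ← Ext.mk₀_comp_mk₀_assoc, ← hy,
    ← Ext.comp_assoc_of_third_deg_zero, hk, Ext.zero_comp]

theorem LocalCohVanishes.right (hf : Function.Injective f) (hfg : Function.Exact f g)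
    (hg : Function.Surjective g) {i : ℕ} (hB : LocalCohVanishes 𝔞 i B)
    (hA : LocalCohVanishes 𝔞 (i + 1) A) : LocalCohVanishes 𝔞 i C := by
  intro m x
  obtain ⟨n, h, hn⟩ := hA m (x.comp (exactPair_shortExact hf hfg hg).extClass rfl)
  rw [← Ext.comp_assoc _ _ _ (zero_add i) rfl (by omega)] at hn
  obtain ⟨y, hy⟩ := Ext.covariant_sequence_exact₃ _ (exactPair_shortExact hf hfg hg) _ rfl hn
  obtain ⟨k, h', hk⟩ := hB n y
  refine ⟨k, h.trans h', ?_⟩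
  rw [← powFactor_comp 𝔞 h h', ← Ext.mk₀_comp_mk₀_assoc, ← hy,
    ← Ext.comp_assoc_of_third_deg_zero, hk, Ext.zero_comp]

theorem LocalCohVanishes.left (hf : Function.Injective f) (hfg : Function.Exact f g)
    (hg : Function.Surjective g) {i : ℕ} (hC : LocalCohVanishes 𝔞 i C)
    (hB : LocalCohVanishes 𝔞 (i + 1) B) : LocalCohVanishes 𝔞 (i + 1) A := by
  intro m x
  obtain ⟨n, h, hn⟩ := hB m (x.comp (Ext.mk₀ (ModuleCat.ofHom f)) (add_zero _))
  rw [← Ext.comp_assoc_of_third_deg_zero] at hn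
  obtain ⟨y, hy⟩ := Ext.covariant_sequence_exact₁ _ (exactPair_shortExact hf hfg hg) _ hn rfl
  obtain ⟨k, h', hk⟩ := hC n y
  refine ⟨k, h.trans h', ?_⟩
  rw [← powFactor_comp 𝔞 h h', ← Ext.mk₀_comp_mk₀_assoc, ← hy,
    ← Ext.comp_assoc _ _ _ (zero_add i) rfl (by omega), hk, Ext.zero_comp]

end Vanishing

/-! ### The torsion functor and its relation to local cohomology in degrees 0 and 1 -/

section Gamma

/-- The submodule of elements killed by a power of `𝔞`. -/
def gamma (𝔞 : Ideal R) (N : Type u) [AddCommGroup N] [Module R N] : Submodule R N where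
  carrier := {y | ∃ n : ℕ, ∀ r ∈ 𝔞 ^ n, r • y = 0}
  zero_mem' := ⟨0, fun r _ => smul_zero r⟩
  add_mem' := by
    rintro a b ⟨m, hm⟩ ⟨n, hn⟩
    refine ⟨max m n, fun r hr => ?_⟩
    rw [smul_add, hm r (Ideal.pow_le_pow_right (le_max_left m n) hr),
      hn r (Ideal.pow_le_pow_right (le_max_right m n) hr), add_zero]
  smul_mem' := by
    rintro s a ⟨m, hm⟩
    exact ⟨m, fun r hr => by rw [smul_comm, hm r hr, smul_zero]⟩

variable {𝔞 : Ideal R} {A B C : Type u} [AddCommGroup A] [Module R A] [AddCommGroup B] [Module R B]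
  [AddCommGroup C] [Module R C] {f : A →ₗ[R] B} {g : B →ₗ[R] C}

theorem map_mem_gamma (f : A →ₗ[R] B) {y : A} (hy : y ∈ gamma 𝔞 A) : f y ∈ gamma 𝔞 B := by
  obtain ⟨n, hn⟩ := hy
  exact ⟨n, fun r hr => by rw [← map_smul, hn r hr, map_zero]⟩

theorem mem_gamma_of_map (hf : Function.Injective f) {y : A} (hy : f y ∈ gamma 𝔞 B) :
    y ∈ gamma 𝔞 A := by
  obtain ⟨n, hn⟩ := hy
  exact ⟨n, fun r hr => hf (by rw [map_smul, hn r hr, map_zero])⟩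

theorem gamma_mono {𝔟 : Ideal R} (h : 𝔟 ≤ 𝔞) : gamma 𝔞 A ≤ gamma 𝔟 A := by
  rintro y ⟨n, hn⟩
  exact ⟨n, fun r hr => hn r (Ideal.pow_right_mono h n hr)⟩

theorem gamma_gamma : gamma 𝔞 (gamma 𝔞 A) = ⊤ :=
  eq_top_iff.2 fun y _ => mem_gamma_of_map (Submodule.subtype_injective _) y.2

theorem gamma_eq_top_of_surjective (h : gamma 𝔞 A = ⊤) (hf : Function.Surjective f) :
    gamma 𝔞 B = ⊤ := by
  refine eq_top_iff.2 fun y _ => ?_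
  obtain ⟨x, rfl⟩ := hf y
  exact map_mem_gamma f (h ▸ Submodule.mem_top)

theorem gamma_sup_of_eq_top {𝔟 : Ideal R} (h : gamma 𝔞 A = ⊤) : gamma (𝔟 ⊔ 𝔞) A = gamma 𝔟 A := by
  refine le_antisymm (gamma_mono le_sup_left) ?_
  rintro y ⟨n, hn⟩
  obtain ⟨m, hm⟩ : y ∈ gamma 𝔞 A := h ▸ Submodule.mem_top
  refine ⟨n + m, fun r hr => ?_⟩
  obtain ⟨s, hs, t, ht, rfl⟩ := Submodule.mem_sup.1 (Ideal.sup_pow_add_le_pow_sup_pow hr)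
  rw [add_smul, hn s hs, hm t ht, add_zero]

theorem exists_pow_smul_eq_zero {N : Submodule R A} (hN : N.FG) (h : N ≤ gamma 𝔞 A) :
    ∃ n : ℕ, ∀ r ∈ 𝔞 ^ n, ∀ y ∈ N, r • y = 0 := by
  induction N, hN using Submodule.fg_induction with
  | singleton x =>
    obtain ⟨m, hm⟩ := h (Submodule.mem_span_singleton_self x)
    refine ⟨m, fun s hs y hy => ?_⟩
    obtain ⟨t, rfl⟩ := Submodule.mem_span_singleton.1 hy
    rw [smul_comm, hm s hs, smul_zero]
  | sup N₁ N₂ _ _ h₁ h₂ =>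
    obtain ⟨m, hm⟩ := h₁ (le_sup_left.trans h)
    obtain ⟨k, hk⟩ := h₂ (le_sup_right.trans h)
    refine ⟨max m k, fun s hs y hy => ?_⟩
    obtain ⟨u, hu, v, hv, rfl⟩ := Submodule.mem_sup.1 hy
    rw [smul_add, hm s (Ideal.pow_le_pow_right (le_max_left m k) hs) u hu,
      hk s (Ideal.pow_le_pow_right (le_max_right m k) hs) v hv, add_zero]

/-- The submodule `𝔞^n y` is finitely generated and torsion, so a single power of `𝔞` kills all of
it. -/
theorem mem_gamma_of_pow_smul_mem [IsNoetherianRing R] {y : A} {n : ℕ}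
    (h : ∀ r ∈ 𝔞 ^ n, r • y ∈ gamma 𝔞 A) : y ∈ gamma 𝔞 A := by
  obtain ⟨m, hm⟩ := exists_pow_smul_eq_zero
    (N := Submodule.map (LinearMap.toSpanSingleton R A y) (𝔞 ^ n))
    (Submodule.FG.map (LinearMap.toSpanSingleton R A y) ((isNoetherianRing_iff_ideal_fg R).1 ‹_› (𝔞 ^ n)))
    (Submodule.map_le_iff_le_comap.2 h)
  refine ⟨m + n, fun r hr => ?_⟩
  rw [pow_add] at hr
  refine Submodule.mul_induction_on hr (fun s hs t ht => ?_) fun s t hs ht => ?_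
  · rw [mul_smul]
    exact hm s hs _ (Submodule.mem_map_of_mem ht)
  · rw [add_smul, hs, ht, add_zero]

/-- The map `R/I → A` that sends `1` to an element killed by `I`. -/
def quotToSpan {I : Ideal R} (y : A) (h : ∀ r ∈ I, r • y = 0) : R ⧸ I →ₗ[R] A :=
  Submodule.liftQ I (LinearMap.toSpanSingleton R A y) h

@[simp] theorem quotToSpan_mk {I : Ideal R} (y : A) (h : ∀ r ∈ I, r • y = 0) (r : R) :
    quotToSpan y h (Submodule.Quotient.mk r) = r • y := rfl

theorem quot_hom_ext {I : Ideal R} {φ ψ : R ⧸ I →ₗ[R] A}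
    (h : φ (Submodule.Quotient.mk 1) = ψ (Submodule.Quotient.mk 1)) : φ = ψ := by
  ext
  exact h

theorem smul_quot_hom_one {I : Ideal R} (φ : R ⧸ I →ₗ[R] A) {r : R} (hr : r ∈ I) :
    r • φ (Submodule.Quotient.mk 1) = 0 := by
  rw [← map_smul, ← Submodule.Quotient.mk_smul, smul_eq_mul, mul_one,
    (Submodule.Quotient.mk_eq_zero I).2 hr, map_zero]

theorem quot_hom_eq_zero_of_gamma_eq_bot (h : gamma 𝔞 A = ⊥) {I : Ideal R} {n : ℕ}
    (hI : 𝔞 ^ n ≤ I) (φ : R ⧸ I →ₗ[R] A) : φ = 0 := by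
  refine quot_hom_ext ?_
  have : φ (Submodule.Quotient.mk 1) ∈ gamma 𝔞 A := ⟨n, fun r hr => smul_quot_hom_one φ (hI hr)⟩
  rw [h] at this
  exact this

theorem localCohVanishes_zero_iff : LocalCohVanishes 𝔞 0 A ↔ gamma 𝔞 A = ⊥ := by
  constructor
  · intro H
    refine eq_bot_iff.2 ?_
    rintro y ⟨m, hm⟩
    obtain ⟨n, h, hn⟩ := H m (Ext.mk₀ (ModuleCat.ofHom (quotToSpan y hm)))
    rw [Ext.mk₀_comp_mk₀, Ext.mk₀_eq_zero_iff] at hn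
    have := congrArg (fun φ => φ.hom (Submodule.Quotient.mk 1)) hn
    exact (one_smul R y).symm.trans this
  · intro h
    exact .of_subsingleton_ext fun n =>
      subsingleton_ext_zero fun φ => quot_hom_eq_zero_of_gamma_eq_bot h le_rfl φ

/-- With an injective middle term, `H¹` of the left term is the obstruction to lifting
torsion elements of the right term. -/
theorem localCohVanishes_one_iff [Module.Injective R B] (hf : Function.Injective f)
    (hfg : Function.Exact f g) (hg : Function.Surjective g) :
    LocalCohVanishes 𝔞 1 A ↔ ∀ y ∈ gamma 𝔞 C, ∃ z ∈ gamma 𝔞 B, g z = y := by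
  have hS := exactPair_shortExact hf hfg hg
  constructor
  · rintro H y ⟨m, hm⟩
    obtain ⟨n, h, hn⟩ := H m ((Ext.mk₀ (ModuleCat.ofHom (quotToSpan y hm))).comp hS.extClass
      (zero_add 1))
    rw [Ext.mk₀_comp_mk₀_assoc] at hn
    obtain ⟨z, hz⟩ := Ext.covariant_sequence_exact₃ _ hS _ (zero_add 1) hn
    obtain ⟨φ, rfl⟩ := Ext.addEquiv₀.symm.surjective z
    have hz' := (Ext.mk₀_comp_mk₀ φ (exactPair hfg).g).symm.trans hz
    have := congrArg (fun φ => φ.hom (Submodule.Quotient.mk 1)) (Ext.mk₀_bijective _ _ |>.1 hz')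
    exact ⟨φ.hom (Submodule.Quotient.mk 1), ⟨n, fun r hr => smul_quot_hom_one φ.hom hr⟩,
      this.trans (one_smul R y)⟩
  · intro H m x
    obtain ⟨x, rfl⟩ := Ext.covariant_sequence_exact₁ _ hS x
      ((subsingleton_ext_of_injective _ 0).elim _ _) (zero_add 1)
    obtain ⟨φ, rfl⟩ := Ext.addEquiv₀.symm.surjective x
    obtain ⟨z, ⟨k, hk⟩, hz⟩ := H (φ.hom (Submodule.Quotient.mk 1))
      ⟨m, fun r hr => smul_quot_hom_one φ.hom hr⟩
    refine ⟨max m k, le_max_left m k, ?_⟩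
    have hk' : ∀ r ∈ 𝔞 ^ max m k, r • z = 0 :=
      fun r hr => hk r (Ideal.pow_le_pow_right (le_max_right m k) hr)
    have h1 : powFactor 𝔞 (le_max_left m k) ≫ φ =
        ModuleCat.ofHom (quotToSpan z hk') ≫ (exactPair hfg).g := by
      refine ModuleCat.hom_ext (quot_hom_ext ?_)
      exact hz.symm.trans (congrArg g (one_smul R z).symm)
    have h2 : (Ext.mk₀ (powFactor 𝔞 (le_max_left m k))).comp (Ext.addEquiv₀.symm φ) (zero_add 0) =
        (Ext.mk₀ (ModuleCat.ofHom (quotToSpan z hk'))).comp (Ext.mk₀ (exactPair hfg).g)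
          (zero_add 0) := by
      rw [Ext.mk₀_comp_mk₀, ← h1]
      exact Ext.mk₀_comp_mk₀ _ _
    rw [← Ext.comp_assoc _ _ _ (zero_add 0) (zero_add 1) (by omega), h2,
      Ext.comp_assoc _ _ _ (zero_add 0) (zero_add 1) (by omega), hS.comp_extClass, Ext.comp_zero]

end Gamma

/-! ### Torsion and torsion-free injective embeddings -/

section Embeddings

variable {𝔞 : Ideal R} {N : Type u} [AddCommGroup N] [Module R N]

/-- Over a Noetherian ring, the `𝔞`-torsion part of an injective module is injective. -/
instance gamma_injective [IsNoetherianRing R] [Module.Injective R N] :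
    Module.Injective R (gamma 𝔞 N) := by
  refine Module.Baer.injective fun I g => ?_
  obtain ⟨n, hn⟩ := exists_pow_smul_eq_zero (𝔞 := 𝔞) (N := LinearMap.range g)
    (IsNoetherian.noetherian (⊤ : Submodule R I) |>.map g |> fun h => by
      rwa [Submodule.map_top] at h) (gamma_gamma (𝔞 := 𝔞) (A := N) ▸ le_top)
  -- Artin-Rees gives `𝔞^(n+k) ∩ I ⊆ 𝔞^n I`, which `g` kills. Hence `g` factors through a submodule
  -- of `R/𝔞^(n+k)`, and any extension from there has torsion values.
  obtain ⟨k, hk⟩ := Ideal.exists_pow_inf_eq_pow_smul 𝔞 I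
  have hker : Submodule.comap I.subtype (𝔞 ^ (n + k)) ≤
      LinearMap.ker ((gamma 𝔞 N).subtype ∘ₗ g) := by
    intro x hx
    have h1 : (x : R) ∈ 𝔞 ^ n • I := by
      have h2 : (x : R) ∈ 𝔞 ^ (n + k) • (⊤ : Submodule R R) ⊓ I :=
        ⟨by simpa using hx, x.2⟩
      rw [hk _ (Nat.le_add_left k n), Nat.add_sub_cancel] at h2
      exact Submodule.smul_mono le_rfl inf_le_right h2
    have h3 : x ∈ 𝔞 ^ n • (⊤ : Submodule R I) := by
      have h4 : Submodule.map I.subtype (𝔞 ^ n • (⊤ : Submodule R I)) = 𝔞 ^ n • I := by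
        rw [Submodule.map_smul'', Submodule.map_top, Submodule.range_subtype]
      rw [← h4] at h1
      obtain ⟨y, hy, hyx⟩ := h1
      rwa [← Subtype.ext hyx]
    refine (Submodule.smul_le.2 fun r hr y _ => ?_ :
      𝔞 ^ n • (⊤ : Submodule R I) ≤ LinearMap.ker ((gamma 𝔞 N).subtype ∘ₗ g)) h3
    rw [LinearMap.mem_ker, map_smul, LinearMap.comp_apply, ← map_smul, hn r hr _ ⟨y, rfl⟩, map_zero]
  let i : I ⧸ Submodule.comap I.subtype (𝔞 ^ (n + k)) →ₗ[R] R ⧸ 𝔞 ^ (n + k) :=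
    Submodule.mapQ _ _ I.subtype le_rfl
  have hi : Function.Injective i := by
    refine (injective_iff_map_eq_zero _).2 fun x hx => ?_
    obtain ⟨x, rfl⟩ := Submodule.Quotient.mk_surjective _ x
    exact (Submodule.Quotient.mk_eq_zero _).2 ((Submodule.Quotient.mk_eq_zero (𝔞 ^ (n + k))).1 hx)
  obtain ⟨h, hh⟩ := Module.Injective.out i hi (Submodule.liftQ _ _ hker)
  refine ⟨LinearMap.codRestrict _ (h ∘ₗ Submodule.mkQ (𝔞 ^ (n + k))) fun r => ?_, fun x hx => ?_⟩
  · refine ⟨n + k, fun s hs => ?_⟩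
    rw [← map_smul, LinearMap.comp_apply, Submodule.mkQ_apply, smul_eq_mul,
      (Submodule.Quotient.mk_eq_zero (𝔞 ^ (n + k))).2 (Ideal.mul_mem_right r _ hs), map_zero]
  · exact Subtype.ext (hh (Submodule.Quotient.mk ⟨x, hx⟩))

theorem injective_of_retract {E : Type u} [AddCommGroup E] [Module R E] [Module.Injective R E]
    (i : N →ₗ[R] E) (p : E →ₗ[R] N) (h : ∀ x, p (i x) = x) : Module.Injective R N where
  out X Y _ _ _ _ f hf g := by
    obtain ⟨k, hk⟩ := Module.Injective.out f hf (i ∘ₗ g)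
    exact ⟨p ∘ₗ k, fun x => (congrArg p (hk x)).trans (h _)⟩

variable (N) in
theorem exists_injective_embedding : ∃ (E : Type u) (_ : AddCommGroup E) (_ : Module R E)
    (_ : Module.Injective R E) (f : N →ₗ[R] E), Function.Injective f := by
  let E := Injective.under (ModuleCat.of R N)
  have : Injective (ModuleCat.of R E) := inferInstanceAs (Injective E)
  exact ⟨E, inferInstance, inferInstance, Module.injective_module_of_injective_object R E,
    (Injective.ι (ModuleCat.of R N)).hom, (ModuleCat.mono_iff_injective _).1 inferInstance⟩

theorem exists_torsion_injective_embedding [IsNoetherianRing R] (h : gamma 𝔞 N = ⊤) :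
    ∃ (E : Type u) (_ : AddCommGroup E) (_ : Module R E) (_ : Module.Injective R E)
      (f : N →ₗ[R] E), Function.Injective f ∧ gamma 𝔞 E = ⊤ := by
  obtain ⟨E, _, _, _, f, hf⟩ := exists_injective_embedding (R := R) N
  refine ⟨gamma 𝔞 E, inferInstance, inferInstance, inferInstance,
    LinearMap.codRestrict _ f fun x => map_mem_gamma f (h ▸ Submodule.mem_top), ?_, gamma_gamma⟩
  exact fun x y hxy => hf (congrArg Subtype.val hxy)

/-- The torsion part of an injective hull module `E` is injective, hence a direct summand; the
complement is injective and torsion-free. Projecting `N` to it stays injective because `N` meets the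
torsion part trivially. -/
theorem exists_torsionfree_injective_embedding [IsNoetherianRing R] (h : gamma 𝔞 N = ⊥) :
    ∃ (E : Type u) (_ : AddCommGroup E) (_ : Module R E) (_ : Module.Injective R E)
      (f : N →ₗ[R] E), Function.Injective f ∧ gamma 𝔞 E = ⊥ := by
  obtain ⟨E, _, _, _, f, hf⟩ := exists_injective_embedding (R := R) N
  obtain ⟨r, hr⟩ := Module.Injective.out (gamma 𝔞 E).subtype (Submodule.subtype_injective _)
    LinearMap.id
  have hp : ∀ x, x - r x ∈ LinearMap.ker r := fun x => by
    rw [LinearMap.mem_ker, map_sub, sub_eq_zero]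
    exact (hr (r x)).symm
  let p : E →ₗ[R] LinearMap.ker r :=
    LinearMap.codRestrict _ (LinearMap.id - (gamma 𝔞 E).subtype ∘ₗ r) hp
  refine ⟨LinearMap.ker r, inferInstance, inferInstance,
    injective_of_retract (LinearMap.ker r).subtype p fun x => Subtype.ext ?_, p ∘ₗ f, ?_, ?_⟩
  · change (x : E) - r x = x
    rw [x.2, ZeroMemClass.coe_zero, sub_zero]
  · refine (injective_iff_map_eq_zero _).2 fun x hx => ?_
    have h1 : f x - r (f x) = 0 := congrArg Subtype.val hx
    have h2 : f x ∈ gamma 𝔞 E := by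
      rw [sub_eq_zero.1 h1]
      exact (r (f x)).2
    have h3 := mem_gamma_of_map hf h2
    rw [h] at h3
    exact h3
  · refine eq_bot_iff.2 fun x hx => Subtype.ext ?_
    have h1 : (x : E) ∈ gamma 𝔞 E := map_mem_gamma (LinearMap.ker r).subtype hx
    have h2 : r (x : E) = ⟨x, h1⟩ := hr ⟨x, h1⟩
    exact congrArg (gamma 𝔞 E).subtype (h2.symm.trans x.2)

end Embeddings

/-! ### Local cohomology of torsion modules -/

section Torsion

variable {𝔞 𝔟 : Ideal R} [IsNoetherianRing R]

theorem LocalCohVanishes.of_torsion (i : ℕ) {N : Type u} [AddCommGroup N] [Module R N]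
    (h : gamma 𝔞 N = ⊤) : LocalCohVanishes 𝔞 (i + 1) N := by
  induction i generalizing N with
  | zero =>
    obtain ⟨E, _, _, _, f, hf, hE⟩ := exists_torsion_injective_embedding h
    refine (localCohVanishes_one_iff hf (LinearMap.exact_map_mkQ_range f)
      (Submodule.mkQ_surjective _)).2 fun y _ => ?_
    obtain ⟨z, rfl⟩ := Submodule.mkQ_surjective _ y
    exact ⟨z, hE ▸ Submodule.mem_top, rfl⟩
  | succ i ih =>
    obtain ⟨E, _, _, _, f, hf, hE⟩ := exists_torsion_injective_embedding h
    exact LocalCohVanishes.left hf (LinearMap.exact_map_mkQ_range f) (Submodule.mkQ_surjective _)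
      (ih (gamma_eq_top_of_surjective hE (Submodule.mkQ_surjective _))) (.of_injective _)

/-- On `𝔞`-torsion modules, local cohomology at `𝔟 + 𝔞` vanishes as soon as it does at `𝔟`. -/
theorem LocalCohVanishes.sup_of_torsion {i : ℕ} {N : Type u} [AddCommGroup N] [Module R N]
    (h : gamma 𝔞 N = ⊤) (hN : LocalCohVanishes 𝔟 (i + 1) N) :
    LocalCohVanishes (𝔟 ⊔ 𝔞) (i + 1) N := by
  induction i generalizing N with
  | zero =>
    obtain ⟨E, _, _, _, f, hf, hE⟩ := exists_torsion_injective_embedding h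
    have hQ := gamma_eq_top_of_surjective hE (Submodule.mkQ_surjective (LinearMap.range f))
    rw [zero_add, localCohVanishes_one_iff hf (LinearMap.exact_map_mkQ_range f)
      (Submodule.mkQ_surjective _)] at hN ⊢
    -- On `𝔞`-torsion modules `𝔟` and `𝔟 + 𝔞` have the same torsion elements, so the two lifting
    -- criteria coincide.
    rwa [gamma_sup_of_eq_top hE, gamma_sup_of_eq_top hQ]
  | succ i ih =>
    obtain ⟨E, _, _, _, f, hf, hE⟩ := exists_torsion_injective_embedding h
    have hQ := gamma_eq_top_of_surjective hE (Submodule.mkQ_surjective (LinearMap.range f))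
    exact LocalCohVanishes.left hf (LinearMap.exact_map_mkQ_range f) (Submodule.mkQ_surjective _)
      (ih hQ (LocalCohVanishes.right hf (LinearMap.exact_map_mkQ_range f)
        (Submodule.mkQ_surjective _) (.of_injective _) hN)) (.of_injective _)

end Torsion

/-! ### Vanishing above the number of generators -/

section Vanishing

/-- Multiplication by `x^n` on `Ext(R/𝔞^n, N)` is zero through the first argument and bijective
through the second. -/
theorem LocalCohVanishes.of_smul_bijective {𝔞 : Ideal R} {N : Type u} [AddCommGroup N] [Module R N]
    {x : R} (hx : x ∈ 𝔞) (h : Function.Bijective fun y : N => x • y) (i : ℕ) :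
    LocalCohVanishes 𝔞 i N := by
  refine .of_subsingleton_ext fun n => subsingleton_ext_of_smul_bijective (r := x ^ n) ?_ ?_ i
  · intro y
    obtain ⟨y, rfl⟩ := Submodule.Quotient.mk_surjective _ y
    exact (Submodule.Quotient.mk_eq_zero _).2
      (Ideal.mul_mem_right y _ (Ideal.pow_mem_pow hx n))
  · have := h.iterate n
    rwa [show ((fun y : N => x • y)^[n]) = fun y => x ^ n • y from smul_iterate x n] at this

theorem exists_localization_embedding {N : Type u} [AddCommGroup N] [Module R N] {x : R}
    (h : gamma (Ideal.span {x}) N = ⊥) : ∃ (L : Type u) (_ : AddCommGroup L) (_ : Module R L)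
      (f : N →ₗ[R] L), Function.Injective f ∧ (Function.Bijective fun y : L => x • y) ∧
        gamma (Ideal.span {x}) (L ⧸ LinearMap.range f) = ⊤ := by
  refine ⟨LocalizedModule (Submonoid.powers x) N, inferInstance, inferInstance,
    LocalizedModule.mkLinearMap _ N, ?_, ?_, ?_⟩
  · refine (injective_iff_map_eq_zero _).2 fun y hy => ?_
    obtain ⟨⟨_, n, rfl⟩, hn⟩ := (IsLocalizedModule.eq_zero_iff (Submonoid.powers x) _).1 hy
    have : y ∈ gamma (Ideal.span {x}) N := by
      refine ⟨n, fun r hr => ?_⟩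
      rw [Ideal.span_singleton_pow, Ideal.mem_span_singleton'] at hr
      obtain ⟨s, rfl⟩ := hr
      rw [mul_smul]
      exact (congrArg (s • ·) hn).trans (smul_zero s)
    rw [h] at this
    exact this
  · exact (Module.End.isUnit_iff _).1 (IsLocalizedModule.map_units
      (LocalizedModule.mkLinearMap (Submonoid.powers x) N) ⟨x, Submonoid.mem_powers x⟩)
  · refine eq_top_iff.2 fun y _ => ?_
    obtain ⟨y, rfl⟩ := Submodule.mkQ_surjective _ y
    obtain ⟨⟨z, ⟨_, n, rfl⟩⟩, hz⟩ :=
      IsLocalizedModule.surj (Submonoid.powers x) (LocalizedModule.mkLinearMap _ N) y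
    refine ⟨n, fun r hr => ?_⟩
    rw [Ideal.span_singleton_pow, Ideal.mem_span_singleton'] at hr
    obtain ⟨s, rfl⟩ := hr
    rw [mul_smul, ← map_smul]
    have h0 : (LinearMap.range (LocalizedModule.mkLinearMap (Submonoid.powers x) N)).mkQ
        (x ^ n • y) = 0 := (Submodule.Quotient.mk_eq_zero _).2 ⟨z, hz.symm⟩
    rw [h0, smul_zero]

theorem gamma_bot (N : Type u) [AddCommGroup N] [Module R N] : gamma (⊥ : Ideal R) N = ⊤ := by
  refine eq_top_iff.2 fun y _ => ⟨1, fun r hr => ?_⟩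
  rw [pow_one] at hr
  rw [(Submodule.mem_bot R).1 hr, zero_smul]

variable [IsNoetherianRing R]

theorem gamma_quotient_gamma (𝔞 : Ideal R) (N : Type u) [AddCommGroup N] [Module R N] :
    gamma 𝔞 (N ⧸ gamma 𝔞 N) = ⊥ := by
  refine eq_bot_iff.2 ?_
  rintro y ⟨n, hn⟩
  obtain ⟨y, rfl⟩ := Submodule.mkQ_surjective _ y
  refine (Submodule.Quotient.mk_eq_zero _).2 (mem_gamma_of_pow_smul_mem (n := n) fun r hr => ?_)
  exact (Submodule.Quotient.mk_eq_zero _).1 (hn r hr)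

/-- Local cohomology vanishes above the number of generators of the ideal. -/
theorem LocalCohVanishes.of_card_lt (s : Finset R) {i : ℕ} (hi : s.card < i) {N : Type u}
    [AddCommGroup N] [Module R N] : LocalCohVanishes (Ideal.span (s : Set R)) i N := by
  classical
  induction s using Finset.induction_on generalizing i N with
  | empty =>
    obtain ⟨i, rfl⟩ := Nat.exists_eq_succ_of_ne_zero hi.ne'
    rw [Finset.coe_empty, Ideal.span_empty]
    exact .of_torsion i (gamma_bot N)
  | insert x s hx ih =>
    rw [Finset.card_insert_of_notMem hx] at hi
    obtain ⟨i, rfl⟩ : ∃ j, i = j + 2 := ⟨i - 2, by omega⟩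
    have hs : Ideal.span ((insert x s : Finset R) : Set R) =
        Ideal.span (s : Set R) ⊔ Ideal.span {x} := by
      rw [Finset.coe_insert, Ideal.span_insert, sup_comm]
    have hxs : x ∈ Ideal.span (s : Set R) ⊔ Ideal.span {x} :=
      Ideal.mem_sup_right (Ideal.mem_span_singleton_self x)
    rw [hs]
    -- On `x`-torsion modules the extra generator `x` costs no degree. The general case loses one:
    -- modulo its `x`-torsion, `N` embeds in its localization at `x`, which has no local cohomology,
    -- with an `x`-torsion cokernel one degree lower.
    have key : ∀ {j : ℕ} (_ : s.card < j + 1) {T : Type u} [AddCommGroup T] [Module R T],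
        gamma (Ideal.span {x}) T = ⊤ →
        LocalCohVanishes (Ideal.span (s : Set R) ⊔ Ideal.span {x}) (j + 1) T :=
      fun hj _ _ _ hT => .sup_of_torsion hT (ih hj)
    obtain ⟨L, _, _, f, hf, hL, hQ⟩ :=
      exists_localization_embedding (gamma_quotient_gamma (Ideal.span {x}) N)
    refine LocalCohVanishes.middle (gamma (Ideal.span {x}) N).subtype_injective
      (LinearMap.exact_subtype_mkQ _) (Submodule.mkQ_surjective _) (key (by omega) gamma_gamma) ?_
    exact LocalCohVanishes.left hf (LinearMap.exact_map_mkQ_range f) (Submodule.mkQ_surjective _)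
      (key (by omega) hQ) (.of_smul_bijective hxs hL _)

end Vanishing

/-! ### Cohomological dimension of finitely generated modules -/

section Finite

theorem subsingleton_ext_of_subsingleton {A : Type u} [AddCommGroup A] [Module R A]
    [Subsingleton A] (X : ModuleCat.{u} R) (i : ℕ) :
    Subsingleton (Ext X (ModuleCat.of R A) i) := by
  refine subsingleton_of_forall_eq 0 fun x => ?_
  have h : 𝟙 (ModuleCat.of R A) = 0 := by
    ext a
    exact Subsingleton.elim (α := A) _ _
  rw [← Ext.comp_mk₀_id x, h, Ext.mk₀_zero, Ext.comp_zero]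

variable {𝔞 : Ideal R}

theorem LocalCohVanishes.pi_fin {i : ℕ} (h : LocalCohVanishes 𝔞 i R) (n : ℕ) :
    LocalCohVanishes 𝔞 i (Fin n → R) := by
  induction n with
  | zero => exact .of_subsingleton_ext fun n => subsingleton_ext_of_subsingleton _ i
  | succ n ih =>
    refine LocalCohVanishes.middle (f := LinearMap.single R (fun _ : Fin (n + 1) => R) 0)
      (g := LinearMap.funLeft R R Fin.succ) (fun a b hab => Pi.single_injective (M := fun _ : Fin (n + 1) => R) 0 hab) ?_
      (LinearMap.funLeft_surjective_of_injective R R _ (Fin.succ_injective n)) h ih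
    intro v
    constructor
    · intro hv
      refine ⟨v 0, funext fun j => ?_⟩
      refine Fin.cases ?_ (fun j => ?_) j
      · simp
      · have := congrFun hv j
        simpa [LinearMap.funLeft_apply] using this.symm
    · rintro ⟨r, rfl⟩
      ext j
      simp [LinearMap.funLeft_apply]

variable [IsNoetherianRing R]

theorem exists_localCohVanishes_of_lt (𝔞 : Ideal R) : ∃ b : ℕ, ∀ {i : ℕ} (_ : b < i)
    {N : Type u} [AddCommGroup N] [Module R N], LocalCohVanishes 𝔞 i N := by
  obtain ⟨s, rfl⟩ := (isNoetherianRing_iff_ideal_fg R).1 ‹_› 𝔞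
  exact ⟨s.card, fun hi _ _ _ => .of_card_lt s hi⟩

/-- The cohomological dimension of a finitely generated module is at most that of the ring. -/
theorem LocalCohVanishes.of_finite {c : ℕ} (h : ∀ i, c < i → LocalCohVanishes 𝔞 i R) {i : ℕ}
    (hi : c < i) {N : Type u} [AddCommGroup N] [Module R N] [Module.Finite R N] :
    LocalCohVanishes 𝔞 i N := by
  obtain ⟨b, hb⟩ := exists_localCohVanishes_of_lt 𝔞
  -- Descending induction on `i`, with `k` bounding the distance to the range above `b`. The bound
  -- must be uniform in the module, since each step replaces `N` by a syzygy.
  obtain ⟨k, hk⟩ : ∃ k, b < i + k := ⟨b + 1, by omega⟩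
  induction k generalizing i N with
  | zero => exact hb hk
  | succ k ih =>
    obtain ⟨n, f, hf⟩ := Module.Finite.exists_fin' R N
    exact LocalCohVanishes.right (LinearMap.ker f).subtype_injective
      (LinearMap.exact_subtype_ker_map f) hf ((h i hi).pi_fin n) (ih (by omega) (by omega))

end Finite

/-! ### Comparing Ext of a module with Ext of its local cohomology -/

section Comparison

variable {𝔞 : Ideal R} {N : Type u} [AddCommGroup N] [Module R N]

theorem subsingleton_ext_of_gamma_eq_bot [Module.Injective R N] (h : gamma 𝔞 N = ⊥) {I : Ideal R}
    {n : ℕ} (hI : 𝔞 ^ n ≤ I) (i : ℕ) : Subsingleton (ExtMod (R := R) (R ⧸ I) N i) := by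
  cases i with
  | zero => exact subsingleton_ext_zero fun φ => quot_hom_eq_zero_of_gamma_eq_bot h hI φ
  | succ i => exact subsingleton_ext_of_injective _ i

/-- Degree 0 is torsion-freeness. In a torsion-free injective embedding the cokernel inherits the
hypothesis, and its `Ext^i` surjects onto `Ext^(i+1)` of `N`. -/
theorem subsingleton_ext_of_localCohVanishes [IsNoetherianRing R]
    (h : ∀ j, LocalCohVanishes 𝔞 j N) (i : ℕ) : Subsingleton (ExtMod (R := R) (R ⧸ 𝔞) N i) := by
  have h0 := localCohVanishes_zero_iff.1 (h 0)
  induction i generalizing N with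
  | zero =>
    exact subsingleton_ext_zero fun φ => quot_hom_eq_zero_of_gamma_eq_bot h0 (pow_one 𝔞).le φ
  | succ i ih =>
    obtain ⟨E, _, _, _, f, hf, hE⟩ := exists_torsionfree_injective_embedding h0
    have hE' := subsingleton_ext_of_gamma_eq_bot hE (pow_one 𝔞).le
    have hQ : ∀ j, LocalCohVanishes 𝔞 j (E ⧸ LinearMap.range f) := fun j =>
      LocalCohVanishes.right hf (LinearMap.exact_map_mkQ_range f) (Submodule.mkQ_surjective _)
        (.of_subsingleton_ext fun _ => subsingleton_ext_of_gamma_eq_bot hE le_rfl j) (h (j + 1))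
    have := ih hQ (localCohVanishes_zero_iff.1 (hQ 0))
    exact (extClass_comp_bijective hf (LinearMap.exact_map_mkQ_range f)
      (Submodule.mkQ_surjective _) (hE' i) (hE' (i + 1))).2.subsingleton

section Shift

variable {A B C : Type u} [AddCommGroup A] [Module R A] [AddCommGroup B] [Module R B]
  [AddCommGroup C] [Module R C] {f : A →ₗ[R] B} {g : B →ₗ[R] C}

/-- Dimension shifting for local cohomology along an exact sequence whose middle term has
no `Ext`. -/
noncomputable def localCohShift (hf : Function.Injective f) (hfg : Function.Exact f g)
    (hg : Function.Surjective g)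
    (h : ∀ n i, Subsingleton (ExtMod (R := R) (R ⧸ 𝔞 ^ n) B i)) (i : ℕ) :
    LocalCoh 𝔞 i C ≃ₗ[R] LocalCoh 𝔞 (i + 1) A :=
  Module.DirectLimit.congr
    (fun n => LinearEquiv.ofBijective _
      (extClass_comp_bijective hf hfg hg (X := ModuleCat.of R (R ⧸ 𝔞 ^ n)) (h n i) (h n (i + 1))))
    (fun m n hmn => LinearMap.ext fun x =>
      Ext.comp_assoc (Ext.mk₀ (powFactor 𝔞 hmn)) x (exactPair_shortExact hf hfg hg).extClass
        (zero_add i) rfl (by omega))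

end Shift

/-- Evaluation at `1`, identifying `Ext⁰(R/I, N)` with a submodule of `N`. -/
noncomputable def extZeroEval (I : Ideal R) (N : Type u) [AddCommGroup N] [Module R N] :
    ExtMod (R := R) (R ⧸ I) N 0 →ₗ[R] N :=
  LinearMap.applyₗ (Submodule.Quotient.mk (p := I) 1) ∘ₗ
    (ModuleCat.homLinearEquiv (S := R)).toLinearMap ∘ₗ
      (Ext.linearEquiv₀ (R := R)).toLinearMap

theorem extZeroEval_mk₀ (I : Ideal R) (φ : ModuleCat.of R (R ⧸ I) ⟶ ModuleCat.of R N) :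
    extZeroEval I N (Ext.mk₀ φ) = φ.hom (Submodule.Quotient.mk 1) := by
  have : Ext.linearEquiv₀ (R := R) (Ext.mk₀ φ) = φ :=
    (Ext.linearEquiv₀ (R := R)).apply_symm_apply φ
  change (Ext.linearEquiv₀ (R := R) (Ext.mk₀ φ)).hom _ = _
  rw [this]

theorem extZeroEval_injective (I : Ideal R) : Function.Injective (extZeroEval I N) := by
  intro x y hxy
  obtain ⟨φ, rfl⟩ := (Ext.mk₀_bijective _ _).2 x
  obtain ⟨ψ, rfl⟩ := (Ext.mk₀_bijective _ _).2 y
  rw [extZeroEval_mk₀, extZeroEval_mk₀] at hxy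
  rw [ModuleCat.hom_ext (quot_hom_ext hxy)]

/-- The zeroth local cohomology module is the `𝔞`-torsion submodule. -/
theorem nonempty_localCoh_zero_equiv (𝔞 : Ideal R) (N : Type u) [AddCommGroup N] [Module R N] :
    Nonempty (LocalCoh 𝔞 0 N ≃ₗ[R] gamma 𝔞 N) := by
  have hcomp : ∀ m n (h : m ≤ n) (x : ExtMod (R := R) (R ⧸ 𝔞 ^ m) N 0),
      extZeroEval (𝔞 ^ n) N (extTransition 𝔞 N 0 m n h x) = extZeroEval (𝔞 ^ m) N x := by
    intro m n h x
    obtain ⟨φ, rfl⟩ := (Ext.mk₀_bijective _ _).2 x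
    have : extTransition 𝔞 N 0 m n h (Ext.mk₀ φ) = Ext.mk₀ (powFactor 𝔞 h ≫ φ) :=
      Ext.mk₀_comp_mk₀ _ _
    rw [this, extZeroEval_mk₀, extZeroEval_mk₀]
    rfl
  let F : LocalCoh 𝔞 0 N →ₗ[R] N := Module.DirectLimit.lift R ℕ _ _
    (fun n => extZeroEval (𝔞 ^ n) N) hcomp
  have hF : Function.Injective F :=
    Module.DirectLimit.lift_injective _ _ fun n => extZeroEval_injective _
  have hr : LinearMap.range F = gamma 𝔞 N := by
    refine le_antisymm ?_ ?_
    · rintro _ ⟨z, rfl⟩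
      obtain ⟨n, x, rfl⟩ := Module.DirectLimit.exists_of z
      obtain ⟨φ, rfl⟩ := (Ext.mk₀_bijective _ _).2 x
      refine ⟨n, fun r hr => ?_⟩
      simp only [F, Module.DirectLimit.lift_of, extZeroEval_mk₀]
      exact smul_quot_hom_one φ.hom hr
    · rintro y ⟨n, hn⟩
      refine ⟨Module.DirectLimit.of R ℕ _ _ n (Ext.mk₀ (ModuleCat.ofHom (quotToSpan y hn))), ?_⟩
      simp only [F, Module.DirectLimit.lift_of, extZeroEval_mk₀]
      exact one_smul R y
  exact ⟨(LinearEquiv.ofInjective F hF).trans (LinearEquiv.ofEq _ _ hr)⟩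

variable [IsNoetherianRing R]

/-- The quotient `N/Γ(N)` is torsion-free and inherits vanishing in positive degrees, so it has no
local cohomology, hence no `Ext` from `R/𝔞`. -/
theorem subsingleton_ext_gamma_iff (h : ∀ j, LocalCohVanishes 𝔞 (j + 1) N) (i : ℕ) :
    Subsingleton (ExtMod (R := R) (R ⧸ 𝔞) (gamma 𝔞 N) i) ↔
      Subsingleton (ExtMod (R := R) (R ⧸ 𝔞) N i) := by
  have hS := exactPair_shortExact (gamma 𝔞 N).subtype_injective (LinearMap.exact_subtype_mkQ _)
    (Submodule.mkQ_surjective _)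
  have hQ : ∀ j, Subsingleton (ExtMod (R := R) (R ⧸ 𝔞) (N ⧸ gamma 𝔞 N) j) := by
    refine subsingleton_ext_of_localCohVanishes fun j => ?_
    cases j with
    | zero => exact localCohVanishes_zero_iff.2 (gamma_quotient_gamma 𝔞 N)
    | succ j =>
      exact LocalCohVanishes.right (gamma 𝔞 N).subtype_injective
        (LinearMap.exact_subtype_mkQ _) (Submodule.mkQ_surjective _) (h j)
        (.of_torsion _ gamma_gamma)
  constructor
  · intro hG
    refine subsingleton_of_forall_eq 0 fun x => ?_
    obtain ⟨y, rfl⟩ := Ext.covariant_sequence_exact₂ _ hS x ((hQ i).elim _ _)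
    rw [hG.elim y 0, Ext.zero_comp]
  · intro hN
    refine subsingleton_of_forall_eq 0 fun x => ?_
    cases i with
    | zero =>
      have hfg := LinearMap.exact_subtype_mkQ (gamma 𝔞 N)
      have : Mono (exactPair hfg).f := hS.mono_f
      exact Ext.postcomp_mk₀_injective_of_mono _ (exactPair hfg).f (hN.elim _ _)
    | succ i =>
      obtain ⟨y, rfl⟩ := Ext.covariant_sequence_exact₁ _ hS x (hN.elim _ _) rfl
      rw [(hQ i).elim y 0, Ext.zero_comp]

/-- If local cohomology is concentrated in degree `c`, then the modules
`Ext^i(R/𝔞, H^c(N))` and `Ext^(i+c)(R/𝔞, N)` vanish simultaneously. -/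
theorem subsingleton_ext_localCoh_iff {c : ℕ} (h : ∀ j, j ≠ c → LocalCohVanishes 𝔞 j N) (i : ℕ) :
    Subsingleton (ExtMod (R := R) (R ⧸ 𝔞) (LocalCoh 𝔞 c N) i) ↔
      Subsingleton (ExtMod (R := R) (R ⧸ 𝔞) N (i + c)) := by
  induction c generalizing N with
  | zero =>
    obtain ⟨e⟩ := nonempty_localCoh_zero_equiv 𝔞 N
    exact (subsingleton_ext_congr e _ i).trans
      (subsingleton_ext_gamma_iff (fun j => h _ (Nat.succ_ne_zero j)) i)
  | succ c ih =>
    have h0 := localCohVanishes_zero_iff.1 (h 0 (Nat.succ_ne_zero c).symm)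
    obtain ⟨E, _, _, _, f, hf, hE⟩ := exists_torsionfree_injective_embedding h0
    have hfg := LinearMap.exact_map_mkQ_range f
    have hg := Submodule.mkQ_surjective (LinearMap.range f)
    have hE' := subsingleton_ext_of_gamma_eq_bot hE (pow_one 𝔞).le
    have hE'' : ∀ n i, Subsingleton (ExtMod (R := R) (R ⧸ 𝔞 ^ n) E i) :=
      fun n => subsingleton_ext_of_gamma_eq_bot hE le_rfl
    have hQ : ∀ j, j ≠ c → LocalCohVanishes 𝔞 j (E ⧸ LinearMap.range f) := fun j hj =>
      LocalCohVanishes.right hf hfg hg (.of_subsingleton_ext fun n => hE'' n j)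
        (h (j + 1) (by omega))
    -- Passing to the cokernel lowers by one both the degree of local cohomology and the degree of
    -- `Ext(R/𝔞, -)`, while `i` stays fixed.
    rw [← subsingleton_ext_congr (localCohShift hf hfg hg hE'' c), ih hQ]
    exact (Equiv.ofBijective _ (extClass_comp_bijective hf hfg hg (hE' (i + c))
      (hE' (i + c + 1)))).subsingleton_congr

end Comparison

/-! ### Grade as the least nonvanishing Ext degree -/

section Grade

open Pointwise

theorem smul_top_quotSMulTop_ne_top {M : Type u} [AddCommGroup M] [Module R M] {I : Ideal R}
    {r : R} (hr : r ∈ I) (hI : I • (⊤ : Submodule R M) ≠ ⊤) :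
    I • (⊤ : Submodule R (QuotSMulTop r M)) ≠ ⊤ := by
  intro h
  have := congrArg (Submodule.comap (Submodule.mkQ _)) h
  rw [Submodule.comap_smul_top_of_surjective I _ (Submodule.mkQ_surjective _), Submodule.ker_mkQ,
    Submodule.comap_top, sup_eq_left.2] at this
  · exact hI this
  · rw [← Submodule.ideal_span_singleton_smul]
    exact Submodule.smul_mono_left ((Ideal.span_singleton_le_iff_mem I).mpr hr)

theorem support_quotient (I : Ideal R) :
    Module.support R (R ⧸ I) = PrimeSpectrum.zeroLocus I := by
  rw [Module.support_eq_zeroLocus, Ideal.annihilator_quotient]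

variable [IsNoetherianRing R] {𝔞 : Ideal R}

theorem exists_isSMulRegular_of_subsingleton_ext {M : Type u} [AddCommGroup M] [Module R M]
    [Module.Finite R M] (hM : 𝔞 • (⊤ : Submodule R M) ≠ ⊤)
    (h : Subsingleton (ExtMod (R := R) (R ⧸ 𝔞) M 0)) : ∃ x ∈ 𝔞, IsSMulRegular M x := by
  obtain ⟨rs, hlen, hmem, hreg⟩ := ModuleCat.exists_isRegular_of_exists_subsingleton_ext 𝔞 1
    (ModuleCat.of R M) hM.lt_top (ModuleCat.of R (R ⧸ 𝔞)) (support_quotient 𝔞) fun i hi => by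
      obtain rfl : i = 0 := by omega
      exact h
  obtain ⟨x, rfl⟩ := List.length_eq_one_iff.1 hlen
  exact ⟨x, hmem x (List.mem_singleton_self x),
    ((RingTheory.Sequence.isRegular_cons_iff M x []).1 hreg).1⟩

theorem exists_not_subsingleton_ext {M : Type u} [AddCommGroup M] [Module R M] [Module.Finite R M]
    (hM : 𝔞 • (⊤ : Submodule R M) ≠ ⊤) :
    ∃ i, ¬ Subsingleton (ExtMod (R := R) (R ⧸ 𝔞) M i) := by
  by_contra! H
  -- If every `Ext` vanished, `𝔞` would contain a regular element on the quotient `Q`, and dividing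
  -- by it would preserve the situation. The kernels of `M → Q` would then increase strictly
  -- forever.
  have key : ∀ K : Submodule R M, ∀ (Q : Type u) [AddCommGroup Q] [Module R Q] (f : M →ₗ[R] Q),
      Function.Surjective f → LinearMap.ker f = K → 𝔞 • (⊤ : Submodule R Q) ≠ ⊤ →
      ¬ ∀ i, Subsingleton (ExtMod (R := R) (R ⧸ 𝔞) Q i) := by
    intro K
    induction K using WellFoundedGT.induction with
    | ind K ih =>
      intro Q _ _ f hf hK hQ hE
      have : Module.Finite R Q := Module.Finite.of_surjective f hf
      obtain ⟨x, hx, hreg⟩ := exists_isSMulRegular_of_subsingleton_ext hQ (hE 0)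
      let π := (x • (⊤ : Submodule R Q)).mkQ
      refine ih (LinearMap.ker (π ∘ₗ f)) ?_ (QuotSMulTop x Q) (π ∘ₗ f)
        ((Submodule.mkQ_surjective _).comp hf) rfl (smul_top_quotSMulTop_ne_top hx hQ) fun i => ?_
      · rw [← hK]
        -- If the kernel did not grow, `x` would kill `Q`; being regular on `Q`, it would force `Q =
        -- 0`.
        refine lt_of_le_of_ne (LinearMap.ker_le_ker_comp f π) fun heq => hQ ?_
        have hQ0 : ∀ q : Q, q = 0 := fun q => by
          obtain ⟨m, rfl⟩ := hf q
          have hm : x • m ∈ LinearMap.ker (π ∘ₗ f) := by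
            rw [LinearMap.mem_ker, LinearMap.comp_apply, map_smul]
            exact (Submodule.Quotient.mk_eq_zero _).2
              (Submodule.smul_mem_pointwise_smul _ _ _ Submodule.mem_top)
          rw [← heq, LinearMap.mem_ker, map_smul] at hm
          exact hreg (hm.trans (smul_zero x).symm)
        exact eq_top_iff.2 fun q _ => by rw [hQ0 q]; exact zero_mem _
      · refine subsingleton_of_forall_eq 0 fun y => ?_
        obtain ⟨z, rfl⟩ := Ext.covariant_sequence_exact₃ _
          (IsSMulRegular.smulShortComplex_shortExact (M := ModuleCat.of R Q) hreg) y rfl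
          ((hE (i + 1)).elim _ _)
        obtain rfl : z = 0 := (hE i).elim z 0
        exact Ext.zero_comp ..
  exact key _ M LinearMap.id Function.surjective_id rfl hM H

/-- The grade is the least `i` with `Ext^i(R/𝔞, M) ≠ 0`. -/
theorem exists_idealGrade_eq {M : Type u} [AddCommGroup M] [Module R M] [Module.Finite R M]
    (hM : 𝔞 • (⊤ : Submodule R M) ≠ ⊤) : ∃ g : ℕ, idealGrade 𝔞 M = g ∧
      (∀ n, ∀ i < g, Subsingleton (ExtMod (R := R) (R ⧸ 𝔞 ^ n) M i)) ∧
      (∀ i < g, Subsingleton (ExtMod (R := R) (R ⧸ 𝔞) M i)) ∧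
      ¬ Subsingleton (ExtMod (R := R) (R ⧸ 𝔞) M g) := by
  classical
  have hex := exists_not_subsingleton_ext hM
  have hlt : ∀ i < Nat.find hex, Subsingleton (ExtMod (R := R) (R ⧸ 𝔞) M i) :=
    fun i hi => not_not.1 (Nat.find_min hex hi)
  obtain ⟨rs, hlen, hmem, hreg⟩ := ModuleCat.exists_isRegular_of_exists_subsingleton_ext 𝔞
    (Nat.find hex) (ModuleCat.of R M) hM.lt_top (ModuleCat.of R (R ⧸ 𝔞)) (support_quotient 𝔞) hlt
  refine ⟨Nat.find hex, ?_, fun n i hi => ?_, hlt, Nat.find_spec hex⟩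
  · rw [idealGrade, if_neg hM]
    refine le_antisymm (iSup₂_le fun rs' h' => ?_) ?_
    · refine Nat.cast_le.2 (not_lt.1 fun hlt' => Nat.find_spec hex ?_)
      exact ModuleCat.subsingleton_ext_of_exists_isRegular 𝔞 (ModuleCat.of R (R ⧸ 𝔞))
        (support_quotient 𝔞).le (ModuleCat.of R M) hM.lt_top rs' h'.1 h'.2 _ hlt'
    · rw [← hlen]
      exact le_iSup₂ (f := fun (rs : List R)
        (_ : (∀ r ∈ rs, r ∈ 𝔞) ∧ RingTheory.Sequence.IsRegular M rs) => (rs.length : ℕ∞))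
        rs ⟨hmem, hreg⟩
  -- The support of `R/𝔞^n` lies in `V(𝔞)`, so the same regular sequence works for every power.
  · refine ModuleCat.subsingleton_ext_of_exists_isRegular 𝔞 (ModuleCat.of R (R ⧸ 𝔞 ^ n))
      ((support_quotient (𝔞 ^ n)).le.trans ?_) (ModuleCat.of R M) hM.lt_top rs hmem hreg i
      (hlen.symm ▸ hi)
    exact (PrimeSpectrum.zeroLocus_subset_zeroLocus_iff _ _).2
      fun x hx => ⟨n, Ideal.pow_mem_pow hx n⟩

end Grade

/-! ### Evaluating the suprema that define the two dimensions -/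

section CohomologicalDimension

variable {𝔞 : Ideal R}

theorem nontrivial_localCoh_iff {i : ℕ} {N : Type u} [AddCommGroup N] [Module R N] :
    Nontrivial (LocalCoh 𝔞 i N) ↔ ¬ LocalCohVanishes 𝔞 i N := by
  rw [← not_subsingleton_iff_nontrivial, subsingleton_localCoh_iff]

/-- The cohomological dimension of a proper ideal of a Noetherian ring is a natural number. -/
theorem exists_cd_eq [IsNoetherianRing R] (h : 𝔞 ≠ ⊤) :
    ∃ c : ℕ, cd 𝔞 R = c ∧ ∀ i, c < i → LocalCohVanishes 𝔞 i R := by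
  classical
  obtain ⟨b, hb⟩ := exists_localCohVanishes_of_lt 𝔞
  have hR : 𝔞 • (⊤ : Submodule R R) ≠ ⊤ := by simpa using h
  obtain ⟨j, hj⟩ : ∃ j, ¬ LocalCohVanishes 𝔞 j R := by
    by_contra! H
    obtain ⟨i, hi⟩ := exists_not_subsingleton_ext hR
    exact hi (subsingleton_ext_of_localCohVanishes H i)
  have hle : ∀ i, ¬ LocalCohVanishes 𝔞 i R → i ≤ b := fun i hi => not_lt.1 fun h => hi (hb h)
  have hmax : ∀ i, Nat.findGreatest (fun i => ¬ LocalCohVanishes 𝔞 i R) b < i →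
      LocalCohVanishes 𝔞 i R := fun i hi => by
    by_contra h
    exact Nat.findGreatest_is_greatest hi (hle i h) h
  refine ⟨Nat.findGreatest (fun i => ¬ LocalCohVanishes 𝔞 i R) b, le_antisymm ?_ ?_, hmax⟩
  · refine iSup₂_le fun i hi => Nat.cast_le.2 (not_lt.1 fun h => ?_)
    exact nontrivial_localCoh_iff.1 hi (hmax i h)
  · exact le_iSup₂ (f := fun (i : ℕ) (_ : Nontrivial (LocalCoh 𝔞 i R)) => (i : WithBot ℕ∞)) _
      (nontrivial_localCoh_iff.2
        (Nat.findGreatest_spec (P := fun i => ¬ LocalCohVanishes 𝔞 i R) (hle j hj) hj))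

/-- The empty supremum is `⊥`, not `0`, hence the nonvanishing clause in degree 0. -/
theorem relInjDim_eq_zero_iff {N : Type u} [AddCommGroup N] [Module R N] :
    relInjDim 𝔞 N = 0 ↔ ¬ Subsingleton (ExtMod (R := R) (R ⧸ 𝔞) N 0) ∧
      ∀ i, 0 < i → Subsingleton (ExtMod (R := R) (R ⧸ 𝔞) N i) := by
  have hle : ∀ i, ¬ Subsingleton (ExtMod (R := R) (R ⧸ 𝔞) N i) →
      (i : WithBot ℕ∞) ≤ relInjDim 𝔞 N := fun i hi =>
    le_iSup₂ (f := fun (i : ℕ) (_ : Nontrivial (ExtMod (R := R) (R ⧸ 𝔞) N i)) => (i : WithBot ℕ∞))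
      i (not_subsingleton_iff_nontrivial.1 hi)
  constructor
  · intro h
    have hpos : ∀ i, 0 < i → Subsingleton (ExtMod (R := R) (R ⧸ 𝔞) N i) := fun i hi => by
      by_contra hi'
      have := hle i hi'
      rw [h, ← Nat.cast_zero, Nat.cast_le] at this
      omega
    refine ⟨fun h0 => ?_, hpos⟩
    have : relInjDim 𝔞 N ≤ ⊥ := iSup₂_le fun i hi => by
      rcases Nat.eq_zero_or_pos i with rfl | hi'
      · exact absurd h0 (not_subsingleton_iff_nontrivial.2 hi)
      · exact absurd (hpos i hi') (not_subsingleton_iff_nontrivial.2 hi)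
    rw [h] at this
    exact absurd (le_bot_iff.1 this) WithBot.zero_ne_bot
  · rintro ⟨h0, hpos⟩
    refine le_antisymm (iSup₂_le fun i hi => ?_) (by simpa using hle 0 h0)
    rcases Nat.eq_zero_or_pos i with rfl | hi'
    · simp
    · exact absurd (hpos i hi') (not_subsingleton_iff_nontrivial.2 hi)

end CohomologicalDimension

end RelHomology

/-- That the cohomological dimension of `𝔞` is a natural number `c` is part of the claim. -/
theorem theorem3p2 {R : Type u} [CommRing R] [IsNoetherianRing R] (𝔞 : Ideal R)
    (M : Type u) [AddCommGroup M] [Module R M] [Module.Finite R M]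
    (hM : 𝔞 • (⊤ : Submodule R M) ≠ ⊤) :
    ∃ c : ℕ, RelHomology.cd 𝔞 R = (c : WithBot ℕ∞) ∧
      List.TFAE [
        RelHomology.IsRelGorenstein 𝔞 M,
        RelHomology.IsRelMaximalCM 𝔞 M ∧
          RelHomology.relInjDim 𝔞 (RelHomology.LocalCoh 𝔞 c M) = 0,
        RelHomology.IsRelMaximalCM 𝔞 M ∧
          ∀ i : ℕ, c < i → Subsingleton (RelHomology.ExtMod (R := R) (R ⧸ 𝔞) M i)] := by
  have h𝔞 : 𝔞 ≠ ⊤ := by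
    rintro rfl
    exact hM (Submodule.top_smul _)
  obtain ⟨c, hc, hvan⟩ := RelHomology.exists_cd_eq h𝔞
  obtain ⟨g, hg, hpow, hlt, hne⟩ := RelHomology.exists_idealGrade_eq hM
  have hCM : RelHomology.IsRelMaximalCM 𝔞 M ↔ g = c := by
    rw [RelHomology.IsRelMaximalCM, hc, hg]
    exact Nat.cast_inj (R := WithBot ℕ∞)
  refine ⟨c, hc, ?_⟩
  tfae_have 1 → 3 := by
    intro h
    have h' : ∀ i, i ≠ c → Subsingleton (RelHomology.ExtMod (R := R) (R ⧸ 𝔞) M i) :=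
      fun i hi => h i (by rw [hc]; exact fun h => hi (Nat.cast_inj.1 h))
    refine ⟨hCM.2 ?_, fun i hi => h' i hi.ne'⟩
    by_contra hgc
    exact hne (h' g hgc)
  tfae_have 3 → 1 := by
    rintro ⟨h1, h2⟩ i hi
    obtain rfl := hCM.1 h1
    rcases lt_trichotomy i g with h | rfl | h
    · exact hlt i h
    · exact absurd hc.symm hi
    · exact h2 i h
  tfae_have 2 ↔ 3 := by
    refine and_congr_right fun h1 => ?_
    obtain rfl := hCM.1 h1
    have hconc : ∀ j, j ≠ g → RelHomology.LocalCohVanishes 𝔞 j M := fun j hj => by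
      rcases lt_or_gt_of_ne hj with h | h
      · exact .of_subsingleton_ext fun n => hpow n j h
      · exact .of_finite hvan h
    have hiff := RelHomology.subsingleton_ext_localCoh_iff hconc
    rw [RelHomology.relInjDim_eq_zero_iff]
    constructor
    · rintro ⟨-, h⟩ i hi
      have := (hiff (i - g)).1 (h _ (Nat.sub_pos_of_lt hi))
      rwa [Nat.sub_add_cancel hi.le] at this
    · intro h
      -- Nonvanishing in degree 0 is automatic: it corresponds to the nonzero `Ext` of `M` in degree
      -- `g`.
      refine ⟨fun h0 => hne ?_, fun i hi => (hiff i).2 (h _ (by omega))⟩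
      have := (hiff 0).1 h0
      rwa [zero_add] at this
  tfae_finish
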